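/- Write $\mathbb N=\{1,2,3,\dots\}$. A Young diagram $Y$ is identified with its set of boxes $(i,j)\in\mathbb N\times\mathbb N$ ($i$ = row, $j$ = column); $|Y|$ is its number of boxes and $Y_i$ the number of boxes in its $i$-th row. It is an $(m,n)$-hook Young diagram if $Y_{m+1}\le n$. For Young diagrams $Y,Z$ let $Z/Y$ be the set of boxes of $Z$ that are not in $Y$. For $(a,b),(c,d)\in\mathbb N\times\mathbb N$ put $(a,b)\le_P(c,d)$ if $a\le c$ and $b\le d$. An admissible order on $X\subset\mathbb N\times\mathbb N$ is a total order $\le_A$ on $X$ such that $(a,b)\le_A(c,d)$ whenever $a\le c$ and $b\ge d$. If $A$ is an admissible order on $X'$, a map $f:X\to X'$ is called $PA$-standard if $x\le_P y$ implies $f(x)\le_A f(y)$. If $A$, $A'$ are admissible orders on $X'$, $X$ respectively, $\mathcal P(X,X';A,A')$ denotes the set of bijections $f:X\to X'$ such that $f$ is $PA$-standard and $f^{-1}$ is $PA'$-standard. Write $f=(f_1,f_2)$ for the coordinate functions. Let $Y,W,Z$ be $(m,n)$-hook Young diagrams with $|Y|+|W|=|Z|$, and let $A'$ be an admissible order on $Z/Y$.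 Let $LR(Y,W)^Z[A']$ be the set of fillings $Q=(Q_{ij})_{(i,j)\in Z/Y}$ of $Z/Y$ by positive integers such that (i) $Q$ is semistandard: its entries increase weakly from left to right in each row and strictly from top to bottom in each column; (ii) $Q$ has content $W$: for every $k\in\mathbb N$ exactly $W_k$ entries of $Q$ are equal to $k$; (iii) the word $w_{A'}(Q)$, i.e. the sequence of the entries of $Q$ listed in the order $A'$ starting from the $A'$-smallest box, is a lattice permutation: in every initial segment and for every $i\in\mathbb N$, the number of $i$'s is at least the number of $(i+1)$'s. For $Q\in LR(Y,W)^Z[A']$ and $(i,j)\in Z/Y$ let $p(Q;i,j)$ be the number of boxes $(i',j')\in Z/Y$ with $Q_{i'j'}=Q_{ij}$ and $j'\ge j$. **Theorem.** Let $Y,W,Z$ be $(m,n)$-hook Young diagrams with $|Y|+|W|=|Z|$, and let $A$, $A'$ be admissible orders on $W$, $Z/Y$, respectively. Then $$\widetilde\Phi(f)_{ij}=f_1(i,j)\qquad((i,j)\in Z/Y)$$ defines a bijection $\widetilde\Phi:\mathcal P(Z/Y,W;A,A')\to LR(Y,W)^Z[A']$, and its inverse $\widetilde\Psi$ is given by $$\widetilde\Psi(Q)(i,j)=(Q_{ij},\,p(Q;i,j))\qquad((i,j)\in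 Z/Y).$$ -/

import Mathlib

/-! Boxes are pairs `(row, column)` of positive integers.  Mathlib's `YoungDiagram` has rows and
columns numbered from `0`, so its cell `(i, j)` is the box `(i + 1, j + 1)`. -/

namespace AdmissiblePicture

/-- A box `(row, column)`, with rows and columns numbered from `1`. -/
abbrev Box : Type := ℕ+ × ℕ+

/-- The set of boxes of a Young diagram. -/
def boxes (Y : YoungDiagram) : Finset Box :=
  Y.cells.image fun c => (c.1.succPNat, c.2.succPNat)

/-- The number of boxes in the `i`-th row, for `i = 1, 2, …`. -/
def rowLength (Y : YoungDiagram) (i : ℕ+) : ℕ := Y.rowLen i.natPred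

/-- The skew diagram `Z / Y`: the boxes of `Z` that are not in `Y`. -/
def skewBoxes (Z Y : YoungDiagram) : Finset Box := boxes Z \ boxes Y

/-- The `(m + 1)`-th row has at most `n` boxes. -/
def IsHook (m n : ℕ) (Y : YoungDiagram) : Prop := rowLength Y m.succPNat ≤ n

/-- The order `(a, b) ≤_P (c, d)`, that is, `a ≤ c` and `b ≤ d`. -/
def LeP (x y : Box) : Prop := x.1 ≤ y.1 ∧ x.2 ≤ y.2

/-- An admissible order on a finite set of boxes: a total order `le` in which `(a, b)` precedes
`(c, d)` whenever `a ≤ c` and `b ≥ d`. -/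
structure AdmissibleOrder (X : Finset Box) where
  /-- The order relation. -/
  le : X → X → Prop
  isLinearOrder : IsLinearOrder X le
  admissible : ∀ x y : X, x.1.1 ≤ y.1.1 → y.1.2 ≤ x.1.2 → le x y

/-- `PA`-standard maps. -/
def IsPAStandard {X Y : Finset Box} (A : AdmissibleOrder Y) (f : X → Y) : Prop :=
  ∀ x y : X, LeP x y → A.le (f x) (f y)

/-- The set of `(A, A')`-admissible pictures from `X` to `Y`. -/
def pictures {X Y : Finset Box} (A : AdmissibleOrder Y) (A' : AdmissibleOrder X) :
    Set (X ≃ Y) :=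
  {f | IsPAStandard A f ∧ IsPAStandard A' f.symm}

/-- A filling of `X` by positive integers is semistandard if its rows are weakly increasing from
left to right and its columns strictly increasing from top to bottom. -/
def IsSemistandard {X : Finset Box} (Q : X → ℕ+) : Prop :=
  (∀ x y : X, x.1.1 = y.1.1 → x.1.2 < y.1.2 → Q x ≤ Q y) ∧
    (∀ x y : X, x.1.2 = y.1.2 → x.1.1 < y.1.1 → Q x < Q y)

open Classical in
/-- The word of `Q` with respect to `A`: the entries of `Q` listed in the order `A`, the
`A`-smallest box first. -/
noncomputable def word {X : Finset Box} (A : AdmissibleOrder X) (Q : X → ℕ+) : List ℕ+ :=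
  haveI := A.isLinearOrder
  ((Finset.univ : Finset X).sort A.le).map Q

/-- In every initial segment, each `i` occurs at least as often as `i + 1`. -/
def IsLatticePermutation (w : List ℕ+) : Prop :=
  ∀ (i : ℕ+) (k : ℕ), (w.take k).count (i + 1) ≤ (w.take k).count i

/-- The content of `Q`: the number of occurrences of each positive integer. -/
def content {X : Finset Box} (Q : X → ℕ+) (k : ℕ+) : ℕ :=
  (Finset.univ.filter fun x : X => Q x = k).card

/-- The set of Littlewood–Richardson tableaux associated with `(Y, W, Z)` and the admissible
order `A` on `Z / Y`. -/
def LR (Y W Z : YoungDiagram) (A : AdmissibleOrder (skewBoxes Z Y)) :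
    Set (skewBoxes Z Y → ℕ+) :=
  {Q | IsSemistandard Q ∧ content Q = rowLength W ∧ IsLatticePermutation (word A Q)}

/-- `p(Q; i, j)`: the number of boxes with the same entry as the box `x = (i, j)` that lie
weakly to the right of `x`, the box `x` included. -/
def p {X : Finset Box} (Q : X → ℕ+) (x : X) : ℕ+ :=
  ⟨(Finset.univ.filter fun y : X => Q y = Q x ∧ x.1.2 ≤ y.1.2).card,
    Finset.card_pos.2 ⟨x, by simp⟩⟩

end AdmissiblePicture

/-! The theorem rests on the notion of a strict bijection `f` from a convex set of boxes `X` to a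
Young diagram (`IsStrict`): going right in a row decreases the column index of the image, going
down a column increases its row index, and `f⁻¹` has the same two properties.  A picture is strict,
because the opposite behaviour would place two boxes in contradictory positions of one of the two
admissible orders (`isStrict_of_mem_pictures`).

For a strict `f`, two boxes `x ≤_P y` never have images with one strictly north-west of the other
(`IsStrict.not_image_lt`, `IsStrict.not_lt_image`).  Both are infinite descents: a corner of the
rectangle spanned by `f x` and `f y` lies in the Young diagram, its preimage `z` and a corner of
the rectangle spanned by `z` and `y` form another pair of the same kind, further up or further to
the left.

The first statement shows that the row function `f₁` of a picture is weakly increasing along rows.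
It is strictly increasing along columns because `f` is strict, its content is that of the row
function of `W`, and the lattice property holds because `f⁻¹` maps the box above `u` to a box that
precedes `f⁻¹ u`.
Since `f⁻¹` reverses the horizontal order in each row of `W`, the column of `f x` is
`p(f₁; x)` (`IsStrict.p_eq`), so that `f` is recovered from `f₁`.

Conversely, equal entries of a semistandard `Q` run from north-east to south-west, so `p(Q; x)` also
counts the entries equal to `Q x` up to `x` in any admissible order
(`IsSemistandard.p_eq_countUpTo`).  Hence the lattice property makes the inverse of
`x ↦ (Q x, p(Q; x))` standard (`le_of_entry_le_of_p_le`); it also makes this map strict, and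
the second descent statement shows that the map itself is standard for every admissible order. -/

namespace AdmissiblePicture

/-! ### Admissible orders as linear orders -/

theorem AdmissibleOrder.antisymm {X : Finset Box} (A : AdmissibleOrder X) {x y : X}
    (h₁ : A.le x y) (h₂ : A.le y x) : x = y :=
  A.isLinearOrder.antisymm x y h₁ h₂

theorem AdmissibleOrder.trans {X : Finset Box} (A : AdmissibleOrder X) {x y z : X}
    (h₁ : A.le x y) (h₂ : A.le y z) : A.le x z :=
  A.isLinearOrder.trans x y z h₁ h₂

theorem AdmissibleOrder.refl {X : Finset Box} (A : AdmissibleOrder X) (x : X) : A.le x x :=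
  A.isLinearOrder.refl x

theorem AdmissibleOrder.total {X : Finset Box} (A : AdmissibleOrder X) (x y : X) :
    A.le x y ∨ A.le y x :=
  A.isLinearOrder.total x y

/-! ### Convex sets of boxes and Young diagrams -/

/-- A set of boxes is convex if it contains every box lying between two of its boxes in the
order `≤_P`. -/
def IsConvex (X : Finset Box) : Prop :=
  ∀ x ∈ X, ∀ y ∈ X, ∀ c : Box, LeP x c → LeP c y → c ∈ X

theorem mem_boxes {Y : YoungDiagram} {c : Box} : c ∈ boxes Y ↔ (c.2 : ℕ) ≤ rowLength Y c.1 := by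
  have hmem : c ∈ boxes Y ↔ (c.1.natPred, c.2.natPred) ∈ Y := by
    simp only [boxes, Finset.mem_image, YoungDiagram.mem_cells]
    constructor
    · rintro ⟨d, hd, rfl⟩
      simpa using hd
    · intro h
      exact ⟨_, h, by simp⟩
  rw [hmem, YoungDiagram.mem_iff_lt_rowLen, rowLength]
  have := PNat.natPred_add_one c.2
  omega

theorem rowLength_antitone (Y : YoungDiagram) : Antitone (rowLength Y) := fun _ _ h =>
  YoungDiagram.rowLen_anti Y _ _ (PNat.natPred_le_natPred.2 h)

theorem mem_boxes_of_leP {Y : YoungDiagram} {c d : Box} (h : LeP c d) (hd : d ∈ boxes Y) :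
    c ∈ boxes Y := by
  rw [mem_boxes] at hd ⊢
  exact (PNat.coe_le_coe _ _ |>.2 h.2).trans (hd.trans (rowLength_antitone Y h.1))

theorem isConvex_skewBoxes (Z Y : YoungDiagram) : IsConvex (skewBoxes Z Y) := by
  intro x hx y hy c hxc hcy
  simp only [skewBoxes, Finset.mem_sdiff] at hx hy ⊢
  exact ⟨mem_boxes_of_leP hcy hy.1, fun hc => hx.2 (mem_boxes_of_leP hxc hc)⟩

theorem card_pnat_le (n : ℕ) (s : Finset ℕ+) (hs : ∀ b, b ∈ s ↔ (b : ℕ) ≤ n) : s.card = n := by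
  rw [← Finset.card_map ⟨fun b : ℕ+ => (b : ℕ), PNat.coe_injective⟩]
  have : s.map ⟨fun b : ℕ+ => (b : ℕ), PNat.coe_injective⟩ = Finset.Icc 1 n := by
    ext a
    simp only [Finset.mem_map, Function.Embedding.coeFn_mk, Finset.mem_Icc, hs]
    constructor
    · rintro ⟨b, hb, rfl⟩
      exact ⟨b.pos, hb⟩
    · rintro ⟨h1, h2⟩
      exact ⟨⟨a, h1⟩, h2, rfl⟩
  rw [this, Nat.card_Icc]
  omega

theorem content_row_boxes (W : YoungDiagram) :
    content (fun u : boxes W => u.1.1) = rowLength W := by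
  funext k
  rw [content, ← Finset.card_image_of_injOn (f := fun u : boxes W => u.1.2)]
  · apply card_pnat_le
    intro b
    simp only [Finset.mem_image, Finset.mem_filter, Finset.mem_univ, true_and]
    constructor
    · rintro ⟨u, rfl, rfl⟩
      exact mem_boxes.1 u.2
    · intro hb
      exact ⟨⟨(k, b), mem_boxes.2 hb⟩, rfl, rfl⟩
  · intro u hu v hv h
    simp only [Finset.coe_filter, Finset.mem_univ, true_and, Set.mem_ofPred_eq] at hu hv
    exact Subtype.ext (Prod.ext (hu.trans hv.symm) h)

/-! ### Bijections that are strict along rows and columns -/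

/-- A bijection `f` is strict if both `f` and its inverse have the following two properties: when
the argument moves to the right within a row, the column index of the image strictly decreases, and
when it moves down within a column, the row index of the image strictly increases. -/
structure IsStrict {X W : Finset Box} (f : X ≃ W) : Prop where
  row : ∀ x y : X, x.1.1 = y.1.1 → x.1.2 < y.1.2 → (f y).1.2 < (f x).1.2
  col : ∀ x y : X, x.1.2 = y.1.2 → x.1.1 < y.1.1 → (f x).1.1 < (f y).1.1
  symm_row : ∀ u v : W, u.1.1 = v.1.1 → u.1.2 < v.1.2 → (f.symm v).1.2 < (f.symm u).1.2
  symm_col : ∀ u v : W, u.1.2 = v.1.2 → u.1.1 < v.1.1 → (f.symm u).1.1 < (f.symm v).1.1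

variable {X : Finset Box} {W : YoungDiagram}

/-- A counterexample `(x, y)` yields another one whose first box lies in a higher row: let `z` be
the preimage of the corner in the row of `f y` and the column of `f x`, and replace `(x, y)` by
`z` and the box in the row of `z` and the column of `y`. -/
theorem IsStrict.not_image_lt {f : X ≃ boxes W} (hf : IsStrict f) (hX : IsConvex X) (x y : X)
    (hxy : LeP x y) (h₁ : (f y).1.1 < (f x).1.1) (h₂ : (f y).1.2 < (f x).1.2) : False := by
  obtain ⟨c, hc⟩ : ∃ c : boxes W, c.1 = ((f y).1.1, (f x).1.2) :=
    ⟨⟨_, mem_boxes_of_leP (c := ((f y).1.1, (f x).1.2)) ⟨h₁.le, le_rfl⟩ (f x).2⟩, rfl⟩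
  obtain ⟨z, rfl⟩ := f.surjective c
  have hz₁ : z.1.1 < x.1.1 := by
    simpa using hf.symm_col (f z) (f x) (by rw [hc]) (by rw [hc]; exact h₁)
  have hz₂ : z.1.2 < y.1.2 := by
    simpa using hf.symm_row (f y) (f z) (by rw [hc]) (by rw [hc]; exact h₂)
  obtain ⟨e, he⟩ : ∃ e : X, e.1 = (z.1.1, y.1.2) :=
    ⟨⟨_, hX z z.2 y y.2 (z.1.1, y.1.2) ⟨le_rfl, hz₂.le⟩ ⟨(hz₁.le.trans hxy.1), le_rfl⟩⟩, rfl⟩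
  refine hf.not_image_lt hX z e ?_ ?_ ?_
  · rw [he]; exact ⟨le_rfl, hz₂.le⟩
  · have := hf.col e y (by rw [he]) (by rw [he]; exact hz₁.trans_le hxy.1)
    rwa [hc]
  · exact hf.row z e (by rw [he]) (by rw [he]; exact hz₂)
termination_by (x.1.1 : ℕ)
decreasing_by exact hz₁

/-- The descent of `IsStrict.not_image_lt` with the roles of rows and columns exchanged: a
counterexample `(x, y)` yields one whose first box lies in a column further to the left. -/
theorem IsStrict.not_lt_image {f : X ≃ boxes W} (hf : IsStrict f) (hX : IsConvex X) (x y : X)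
    (hxy : LeP x y) (h₁ : (f x).1.1 < (f y).1.1) (h₂ : (f x).1.2 < (f y).1.2) : False := by
  obtain ⟨c, hc⟩ : ∃ c : boxes W, c.1 = ((f x).1.1, (f y).1.2) :=
    ⟨⟨_, mem_boxes_of_leP (c := ((f x).1.1, (f y).1.2)) ⟨h₁.le, le_rfl⟩ (f y).2⟩, rfl⟩
  obtain ⟨z, rfl⟩ := f.surjective c
  have hz₁ : z.1.1 < y.1.1 := by
    simpa using hf.symm_col (f z) (f y) (by rw [hc]) (by rw [hc]; exact h₁)
  have hz₂ : z.1.2 < x.1.2 := by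
    simpa using hf.symm_row (f x) (f z) (by rw [hc]) (by rw [hc]; exact h₂)
  obtain ⟨e, he⟩ : ∃ e : X, e.1 = (y.1.1, z.1.2) :=
    ⟨⟨_, hX z z.2 y y.2 (y.1.1, z.1.2) ⟨hz₁.le, le_rfl⟩ ⟨le_rfl, hz₂.le.trans hxy.2⟩⟩, rfl⟩
  refine hf.not_lt_image hX z e ?_ ?_ ?_
  · rw [he]; exact ⟨hz₁.le, le_rfl⟩
  · exact hf.col z e (by rw [he]) (by rw [he]; exact hz₁)
  · have := hf.row e y (by rw [he]) (by rw [he]; exact hz₂.trans_le hxy.2)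
    rwa [hc]
termination_by (x.1.2 : ℕ)
decreasing_by exact hz₂

/-! ### Initial segments of the word -/

open Classical in
/-- The number of entries `k` of `Q` in the boxes up to and including `x` in the order `A`. -/
noncomputable def countUpTo (A : AdmissibleOrder X) (Q : X → ℕ+) (k : ℕ+) (x : X) : ℕ :=
  (Finset.univ.filter fun y : X => A.le y x ∧ Q y = k).card

/-- A nonempty initial segment of the word consists of the entries up to some box. -/
theorem isLatticePermutation_word_iff (A : AdmissibleOrder X) (Q : X → ℕ+) :
    IsLatticePermutation (word A Q) ↔
      ∀ (i : ℕ+) (x : X), countUpTo A Q (i + 1) x ≤ countUpTo A Q i x := by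
  classical
  have := A.isLinearOrder
  set l := (Finset.univ : Finset X).sort A.le with hl
  have hpw : l.Pairwise A.le := Finset.pairwise_sort _ _
  have hnd : l.Nodup := Finset.sort_nodup _ _
  have hmem : ∀ y, y ∈ l := fun y => by simp [hl]
  have hidx : ∀ i j (hi : i < l.length) (hj : j < l.length), A.le l[i] l[j] ↔ i ≤ j := by
    intro i j hi hj
    constructor
    · intro h
      by_contra hlt
      have h' := List.pairwise_iff_getElem.1 hpw j i hj hi (by omega)
      have := (hnd.getElem_inj_iff).1 (A.antisymm h h')
      omega
    · intro h
      rcases h.eq_or_lt with rfl | h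
      · exact A.refl _
      · exact List.pairwise_iff_getElem.1 hpw i j hi hj h
  have hcount : ∀ j (hj : j < l.length) k,
      ((word A Q).take (j + 1)).count k = countUpTo A Q k l[j] := by
    intro j hj k
    have hw : word A Q = l.map Q := by
      simp only [word, hl]
    rw [hw, ← List.map_take, List.count_eq_countP, List.countP_map, List.countP_eq_length_filter,
      countUpTo, ← List.toFinset_card_of_nodup ((hnd.sublist (List.take_sublist _ _)).filter _)]
    congr 1
    ext y
    simp only [List.mem_toFinset, List.mem_filter, Finset.mem_filter, Finset.mem_univ, true_and,
      Function.comp_apply, beq_iff_eq]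
    refine and_congr_left fun _ => ?_
    obtain ⟨i, hi, rfl⟩ := List.getElem_of_mem (hmem y)
    rw [hidx, List.mem_take_iff_getElem]
    constructor
    · rintro ⟨i', hi', h⟩
      have := (hnd.getElem_inj_iff).1 h
      omega
    · intro h
      exact ⟨i, by omega, rfl⟩
  have hlen : (word A Q).length = l.length := by
    simp [word, hl]
  constructor
  · intro h i x
    obtain ⟨j, hj, rfl⟩ := List.getElem_of_mem (hmem x)
    rw [← hcount, ← hcount]
    exact h i (j + 1)
  · intro h i k
    rcases Nat.eq_zero_or_pos (min k l.length) with h0 | h0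
    · rcases Nat.min_eq_zero_iff.1 h0 with rfl | h0
      · simp
      · rw [List.length_eq_zero_iff.1 (hlen.trans h0)]
        simp
    · have hk : (word A Q).take k = (word A Q).take (min k l.length - 1 + 1) := by
        rw [Nat.sub_add_cancel h0, ← hlen, ← List.take_eq_take_min]
      rw [hk, hcount _ (by omega), hcount _ (by omega)]
      exact h i _

theorem countUpTo_antitone {A : AdmissibleOrder X} {Q : X → ℕ+}
    (hQ : IsLatticePermutation (word A Q)) (x : X) : Antitone fun k => countUpTo A Q k x := by
  rw [isLatticePermutation_word_iff] at hQ
  intro k l hkl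
  induction l using PNat.recOn with
  | one => rw [le_antisymm hkl one_le]
  | succ l ih =>
    rcases hkl.eq_or_lt with rfl | h
    · exact le_rfl
    · exact (hQ l x).trans (ih (PNat.lt_add_one_iff.1 h))

/-! ### From pictures to tableaux -/

theorem isStrict_of_mem_pictures {W : Finset Box} {A : AdmissibleOrder W} {A' : AdmissibleOrder X}
    {f : X ≃ W} (hf : f ∈ pictures A A') : IsStrict f := by
  obtain ⟨hP, hP'⟩ := hf
  -- The hypotheses are symmetric in `f` and `f.symm`, so the two halves share their proofs.
  have key : ∀ {X W : Finset Box} {A : AdmissibleOrder W} {A' : AdmissibleOrder X} {f : X ≃ W},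
      IsPAStandard A f → IsPAStandard A' f.symm →
      (∀ x y : X, x.1.1 = y.1.1 → x.1.2 < y.1.2 → (f y).1.2 < (f x).1.2) ∧
      (∀ x y : X, x.1.2 = y.1.2 → x.1.1 < y.1.1 → (f x).1.1 < (f y).1.1) := by
    intro X W A A' f hP hP'
    constructor
    · intro x y h₁ h₂
      by_contra! h
      have hne : x ≠ y := by rintro rfl; exact lt_irrefl _ h₂
      have hA := hP x y ⟨h₁.le, h₂.le⟩
      rcases le_total (f y).1.1 (f x).1.1 with h' | h'
      · exact hne (f.injective (A.antisymm hA (A.admissible _ _ h' h)))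
      · have := hP' (f x) (f y) ⟨h', h⟩
        simp only [Equiv.symm_apply_apply] at this
        exact hne (A'.antisymm this (A'.admissible _ _ h₁.ge h₂.le))
    · intro x y h₁ h₂
      by_contra! h
      have hne : x ≠ y := by rintro rfl; exact lt_irrefl _ h₂
      have hA := hP x y ⟨h₂.le, h₁.le⟩
      rcases le_total (f x).1.2 (f y).1.2 with h' | h'
      · exact hne (f.injective (A.antisymm hA (A.admissible _ _ h h')))
      · have := hP' (f y) (f x) ⟨h, h'⟩
        simp only [Equiv.symm_apply_apply] at this
        exact hne (A'.antisymm (A'.admissible _ _ h₂.le h₁.ge) this)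
  obtain ⟨h₁, h₂⟩ := key hP hP'
  obtain ⟨h₃, h₄⟩ := key (f := f.symm) hP' (by simpa using hP)
  exact ⟨h₁, h₂, h₃, h₄⟩

theorem content_comp_equiv {X W : Finset Box} (f : X ≃ W) (Q : W → ℕ+) :
    content (fun x => Q (f x)) = content Q := by
  funext k
  exact Finset.card_equiv f (by simp)

theorem IsStrict.isSemistandard {f : X ≃ boxes W} (hf : IsStrict f) (hX : IsConvex X) :
    IsSemistandard fun x => (f x).1.1 := by
  refine ⟨fun x y h₁ h₂ => ?_, hf.col⟩
  by_contra! h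
  exact hf.not_image_lt hX x y ⟨h₁.le, h₂.le⟩ h (hf.row x y h₁ h₂)

theorem isLatticePermutation_of_mem_pictures {A : AdmissibleOrder (boxes W)}
    {A' : AdmissibleOrder X} {f : X ≃ boxes W} (hf : f ∈ pictures A A') :
    IsLatticePermutation (word A' fun x => (f x).1.1) := by
  classical
  rw [isLatticePermutation_word_iff]
  intro i x
  -- Moving a box of row `i + 1` of `W` up by one row moves its preimage towards the start.
  have hup : ∀ y : X, (f y).1.1 = i + 1 → LeP (i, (f y).1.2) (f y).1 := fun y hy =>
    ⟨by rw [hy]; exact (PNat.lt_add_right i 1).le, le_rfl⟩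
  refine Finset.card_le_card_of_injOn
    (fun y => if hy : (f y).1.1 = i + 1 then
      f.symm ⟨(i, (f y).1.2), mem_boxes_of_leP (hup y hy) (f y).2⟩ else y) ?_ ?_
  · intro y hy
    simp only [Finset.coe_filter, Finset.mem_univ, true_and, Set.mem_ofPred_eq] at hy ⊢
    rw [dif_pos hy.2]
    refine ⟨A'.trans ?_ hy.1, by simp⟩
    simpa using hf.2 ⟨(i, (f y).1.2), mem_boxes_of_leP (hup y hy.2) (f y).2⟩ (f y) (hup y hy.2)
  · intro y hy z hz h
    simp only [Finset.coe_filter, Finset.mem_univ, true_and, Set.mem_ofPred_eq] at hy hz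
    simp only [dif_pos hy.2, dif_pos hz.2, EmbeddingLike.apply_eq_iff_eq, Subtype.mk.injEq,
      Prod.mk.injEq, true_and] at h
    exact f.injective (Subtype.ext (Prod.ext (hy.2.trans hz.2.symm) h))

/-- Row `k` of `W` is read from right to left in `X`, so the column of `f x` is the number of
boxes of the same row of `W` whose preimages lie weakly to the right of `x`. -/
theorem IsStrict.p_eq {f : X ≃ boxes W} (hf : IsStrict f) (x : X) :
    p (fun x => (f x).1.1) x = (f x).1.2 := by
  have hiff : ∀ y : X, (f y).1.1 = (f x).1.1 → (x.1.2 ≤ y.1.2 ↔ (f y).1.2 ≤ (f x).1.2) := by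
    intro y hy
    constructor
    · intro h
      by_contra! h'
      have := hf.symm_row (f x) (f y) hy.symm h'
      simp only [Equiv.symm_apply_apply] at this
      exact absurd h this.not_ge
    · intro h
      rcases h.eq_or_lt with h | h
      · rw [f.injective (Subtype.ext (Prod.ext hy h))]
      · have := hf.symm_row (f y) (f x) hy h
        simp only [Equiv.symm_apply_apply] at this
        exact this.le
  apply PNat.coe_injective
  change (Finset.univ.filter fun y : X => (f y).1.1 = (f x).1.1 ∧ x.1.2 ≤ y.1.2).card = _
  rw [← Finset.card_image_of_injOn (f := fun y : X => (f y).1.2)]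
  · apply card_pnat_le
    intro b
    simp only [Finset.mem_image, Finset.mem_filter, Finset.mem_univ, true_and, PNat.coe_le_coe]
    constructor
    · rintro ⟨y, ⟨hy, hxy⟩, rfl⟩
      exact (hiff y hy).1 hxy
    · intro hb
      obtain ⟨y, hy⟩ := f.surjective
        ⟨((f x).1.1, b), mem_boxes_of_leP (d := (f x).1) ⟨le_rfl, hb⟩ (f x).2⟩
      have hy' : (f y).1 = ((f x).1.1, b) := by rw [hy]
      have hrow : (f y).1.1 = (f x).1.1 := by rw [hy']
      refine ⟨y, ⟨hrow, (hiff y hrow).2 ?_⟩, ?_⟩ <;> rw [hy']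
      exact hb
  · intro y hy z hz h
    simp only [Finset.coe_filter, Finset.mem_univ, true_and, Set.mem_ofPred_eq] at hy hz
    exact f.injective (Subtype.ext (Prod.ext (hy.1.trans hz.1.symm) h))

/-! ### From tableaux to pictures -/

theorem IsSemistandard.le_of_leP {Q : X → ℕ+} (hQ : IsSemistandard Q) (hX : IsConvex X) {x y : X}
    (h : LeP x y) : Q x ≤ Q y ∧ (x.1.1 < y.1.1 → Q x < Q y) := by
  obtain ⟨c, hc⟩ : ∃ c : X, c.1 = (x.1.1, y.1.2) :=
    ⟨⟨_, hX x x.2 y y.2 (x.1.1, y.1.2) ⟨le_rfl, h.2⟩ ⟨h.1, le_rfl⟩⟩, rfl⟩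
  have hxc : Q x ≤ Q c := by
    rcases h.2.eq_or_lt with h' | h'
    · rw [show x = c from Subtype.ext (by rw [hc, ← h'])]
    · exact hQ.1 x c (by rw [hc]) (by rw [hc]; exact h')
  have hcy : x.1.1 < y.1.1 → Q c < Q y := fun h' =>
    hQ.2 c y (by rw [hc]) (by rw [hc]; exact h')
  refine ⟨?_, fun h' => hxc.trans_lt (hcy h')⟩
  rcases h.1.eq_or_lt with h' | h'
  · rwa [show y = c from Subtype.ext (by rw [hc, h'])]
  · exact (hxc.trans_lt (hcy h')).le

/-- Boxes with equal entries are ordered from north-east to south-west, so every admissible order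
lists them from right to left. -/
theorem IsSemistandard.le_iff_of_eq {Q : X → ℕ+} (hQ : IsSemistandard Q) (hX : IsConvex X)
    (A : AdmissibleOrder X) {x y : X} (h : Q x = Q y) : A.le y x ↔ x.1.2 ≤ y.1.2 := by
  have hrow : ∀ {x y : X}, Q x = Q y → x.1.2 ≤ y.1.2 → A.le y x := by
    intro x y h hxy
    refine A.admissible _ _ ?_ hxy
    by_contra! h'
    exact (((hQ.le_of_leP hX ⟨h'.le, hxy⟩).2 h').ne h)
  refine ⟨fun hyx => ?_, hrow h⟩
  by_contra! h'
  have := A.antisymm hyx (hrow h.symm h'.le)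
  subst this
  exact lt_irrefl _ h'

theorem IsSemistandard.p_eq_countUpTo {Q : X → ℕ+} (hQ : IsSemistandard Q) (hX : IsConvex X)
    (A : AdmissibleOrder X) (x : X) : (p Q x : ℕ) = countUpTo A Q (Q x) x := by
  classical
  change (Finset.univ.filter fun y : X => Q y = Q x ∧ x.1.2 ≤ y.1.2).card = _
  rw [countUpTo]
  congr 1
  ext y
  simp only [Finset.mem_filter, Finset.mem_univ, true_and]
  rw [and_comm]
  exact and_congr_left fun h => (hQ.le_iff_of_eq hX A h.symm).symm

theorem p_le_p {Q : X → ℕ+} {x y : X} (h : Q x = Q y) (hxy : x.1.2 ≤ y.1.2) : p Q y ≤ p Q x := by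
  rw [← PNat.coe_le_coe]
  refine Finset.card_le_card fun z hz => ?_
  simp only [Finset.mem_filter, Finset.mem_univ, true_and] at hz ⊢
  exact ⟨hz.1.trans h.symm, hxy.trans hz.2⟩

theorem p_lt_p {Q : X → ℕ+} {x y : X} (h : Q x = Q y) (hxy : x.1.2 < y.1.2) : p Q y < p Q x := by
  rw [← PNat.coe_lt_coe]
  refine Finset.card_lt_card (Finset.ssubset_iff_of_subset ?_ |>.2 ⟨x, ?_, ?_⟩)
  · intro z hz
    simp only [Finset.mem_filter, Finset.mem_univ, true_and] at hz ⊢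
    exact ⟨hz.1.trans h.symm, hxy.le.trans hz.2⟩
  · simp
  · simp [hxy]

theorem p_le_content (Q : X → ℕ+) (x : X) : (p Q x : ℕ) ≤ content Q (Q x) := by
  refine Finset.card_le_card fun z hz => ?_
  simp only [Finset.mem_filter, Finset.mem_univ, true_and] at hz ⊢
  exact hz.1

/-- The number of boxes is determined by the content. -/
theorem card_eq_of_content_eq {X W : Finset Box} {Q : X → ℕ+} {R : W → ℕ+}
    (h : content Q = content R) : Fintype.card X = Fintype.card W := by
  classical
  set s := Finset.univ.image Q ∪ Finset.univ.image R
  have h₁ := Finset.card_eq_sum_card_fiberwise (s := (Finset.univ : Finset X)) (f := Q) (t := s)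
    (fun x _ => by simp [s])
  have h₂ := Finset.card_eq_sum_card_fiberwise (s := (Finset.univ : Finset W)) (f := R) (t := s)
    (fun x _ => by simp [s])
  rw [← Finset.card_univ, ← Finset.card_univ, h₁, h₂]
  exact Finset.sum_congr rfl fun k _ => congrFun h k

/-- The map `x ↦ (Q x, p(Q; x))` to the boxes of a Young diagram `W` when `Q` has content `W`. -/
def toBoxes (Q : X → ℕ+) (hc : content Q = rowLength W) (x : X) : boxes W :=
  ⟨(Q x, p Q x), mem_boxes.2 ((p_le_content Q x).trans_eq (congrFun hc _))⟩

theorem IsSemistandard.bijective_toBoxes {Q : X → ℕ+} (hQ : IsSemistandard Q)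
    (hc : content Q = rowLength W) : Function.Bijective (toBoxes Q hc) := by
  rw [Fintype.bijective_iff_injective_and_card]
  refine ⟨fun x y h => ?_, card_eq_of_content_eq (hc.trans (content_row_boxes W).symm)⟩
  have h₁ : Q x = Q y := congrArg (fun u : boxes W => u.1.1) h
  have h₂ : p Q x = p Q y := congrArg (fun u : boxes W => u.1.2) h
  rcases lt_trichotomy x.1.2 y.1.2 with h' | h' | h'
  · exact absurd h₂ (p_lt_p h₁ h').ne'
  · rcases lt_trichotomy x.1.1 y.1.1 with h'' | h'' | h''
    · exact absurd h₁ (hQ.2 x y h' h'').ne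
    · exact Subtype.ext (Prod.ext h'' h')
    · exact absurd h₁ (hQ.2 y x h'.symm h'').ne'
  · exact absurd h₂ (p_lt_p h₁.symm h').ne

/-- By the lattice property the boxes up to `y` contain at least `p(Q; y)` entries equal to `Q x`
when `Q x ≤ Q y`, so if `p(Q; x) ≤ p(Q; y)` then `x` is one of these boxes. -/
theorem le_of_entry_le_of_p_le {A : AdmissibleOrder X} {Q : X → ℕ+} (hQ : IsSemistandard Q)
    (hX : IsConvex X) (hL : IsLatticePermutation (word A Q)) {x y : X}
    (h₁ : Q x ≤ Q y) (h₂ : p Q x ≤ p Q y) : A.le x y := by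
  classical
  by_contra h
  have hyx : A.le y x := (A.total x y).resolve_left h
  have hlt : countUpTo A Q (Q x) y < countUpTo A Q (Q x) x := by
    refine Finset.card_lt_card (Finset.ssubset_iff_of_subset ?_ |>.2 ⟨x, ?_, ?_⟩)
    · intro z hz
      simp only [Finset.mem_filter, Finset.mem_univ, true_and] at hz ⊢
      exact ⟨A.trans hz.1 hyx, hz.2⟩
    · simp [A.refl]
    · simp [h]
  have hle := countUpTo_antitone hL y h₁
  rw [← PNat.coe_le_coe, hQ.p_eq_countUpTo hX A, hQ.p_eq_countUpTo hX A] at h₂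
  exact (hlt.trans_le h₂).not_ge hle

theorem isStrict_of_isLatticePermutation {A' : AdmissibleOrder X} {Q : X → ℕ+}
    (hQ : IsSemistandard Q) (hX : IsConvex X) (hL : IsLatticePermutation (word A' Q))
    {f : X ≃ boxes W} (hf : ∀ x, (f x).1 = (Q x, p Q x)) : IsStrict f := by
  have hle : ∀ x y, Q x ≤ Q y → p Q x ≤ p Q y → A'.le x y := fun x y =>
    le_of_entry_le_of_p_le hQ hX hL
  refine ⟨fun x y h₁ h₂ => ?_, fun x y h₁ h₂ => ?_, fun u v h₁ h₂ => ?_, fun u v h₁ h₂ => ?_⟩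
  · simp only [hf]
    by_contra! h
    have := A'.antisymm (hle x y (hQ.1 x y h₁ h₂) h) (A'.admissible _ _ h₁.ge h₂.le)
    exact h₂.ne (by rw [this])
  · simp only [hf]
    exact hQ.2 x y h₁ h₂
  · obtain ⟨x, rfl⟩ := f.surjective u
    obtain ⟨y, rfl⟩ := f.surjective v
    simp only [hf, Equiv.symm_apply_apply] at h₁ h₂ ⊢
    by_contra! h
    exact h₂.not_ge (p_le_p h₁ h)
  · obtain ⟨x, rfl⟩ := f.surjective u
    obtain ⟨y, rfl⟩ := f.surjective v
    simp only [hf, Equiv.symm_apply_apply] at h₁ h₂ ⊢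
    by_contra! h
    have hxy := hle x y h₂.le h₁.le
    rcases le_total x.1.2 y.1.2 with h' | h'
    · have := A'.antisymm hxy (A'.admissible _ _ h h')
      exact h₂.ne (by rw [this])
    · exact (hQ.le_of_leP hX ⟨h, h'⟩).1.not_gt h₂

theorem mem_pictures_of_isLatticePermutation (A : AdmissibleOrder (boxes W))
    {A' : AdmissibleOrder X} {Q : X → ℕ+}
    (hQ : IsSemistandard Q) (hX : IsConvex X) (hL : IsLatticePermutation (word A' Q))
    {f : X ≃ boxes W} (hf : ∀ x, (f x).1 = (Q x, p Q x)) : f ∈ pictures A A' := by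
  have hs := isStrict_of_isLatticePermutation hQ hX hL hf
  constructor
  · intro x y hxy
    have h₁ : (f x).1.1 ≤ (f y).1.1 := by
      simp only [hf]
      exact (hQ.le_of_leP hX hxy).1
    refine A.admissible _ _ h₁ ?_
    by_contra! h
    rcases h₁.eq_or_lt with h' | h'
    · have := hs.symm_row _ _ h' h
      simp only [Equiv.symm_apply_apply] at this
      exact this.not_ge hxy.2
    · exact hs.not_lt_image hX x y hxy h' h
  · intro u v huv
    obtain ⟨x, rfl⟩ := f.surjective u
    obtain ⟨y, rfl⟩ := f.surjective v
    simp only [Equiv.symm_apply_apply]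
    simp only [LeP, hf] at huv
    exact le_of_entry_le_of_p_le hQ hX hL huv.1 huv.2

end AdmissiblePicture

/-! ### The bijection -/

open AdmissiblePicture in
theorem theorem3p3 (m n : ℕ) (Y W Z : YoungDiagram)
    (hY : IsHook m n Y) (hW : IsHook m n W) (hZ : IsHook m n Z)
    (hcard : Y.card + W.card = Z.card)
    (A : AdmissibleOrder (boxes W)) (A' : AdmissibleOrder (skewBoxes Z Y)) :
    ∃ Φ : pictures A A' ≃ LR Y W Z A',
      (∀ (f : pictures A A') (x : skewBoxes Z Y), (Φ f).1 x = (f.1 x).1.1) ∧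
      (∀ (Q : LR Y W Z A') (x : skewBoxes Z Y), ((Φ.symm Q).1 x).1 = (Q.1 x, p Q.1 x)) := by
  have hX := isConvex_skewBoxes Z Y
  refine ⟨{
    toFun := fun f => ⟨fun x => (f.1 x).1.1,
      (isStrict_of_mem_pictures f.2).isSemistandard hX,
      (content_comp_equiv f.1 fun u => u.1.1).trans (content_row_boxes W),
      isLatticePermutation_of_mem_pictures f.2⟩
    invFun := fun Q => ⟨Equiv.ofBijective (toBoxes Q.1 Q.2.2.1) (Q.2.1.bijective_toBoxes Q.2.2.1),
      mem_pictures_of_isLatticePermutation A Q.2.1 hX Q.2.2.2 fun _ => rfl⟩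
    left_inv := fun f => Subtype.ext (Equiv.ext fun x =>
      Subtype.ext (Prod.ext rfl ((isStrict_of_mem_pictures f.2).p_eq x)))
    right_inv := fun _ => rfl }, fun _ _ => rfl, fun _ _ => rfl⟩
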